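/- **Proposition.** Let $s\ge 1$ be an integer and let $c_1,\dots,c_s\ge 1$ be pairwise distinct integers. There is a constant $C$, depending only on $s$ and $c_1,\dots,c_s$, with the following property. Let $(X,\mu,T)$ be any measure preserving system, that is, a probability space $(X,\mu)$ with an invertible bi-measurable map $T:X\to X$ preserving $\mu$. Let $(b_n)_{n\in\mathbb N}$ be any complex sequence with $|b_n|\le 1$ for all $n$, let $f_1,\dots,f_s\in L^\infty(\mu)$ be complex-valued with $\|f_i\|_{L^\infty(\mu)}\le 1$, and let $(\Phi_N)_{N\in\mathbb N}$ be any Følner sequence in $\mathbb N$. Then $$\limsup_{N\to\infty}\Big\|\frac1{|\Phi_N|}\sum_{n\in\Phi_N} b_n\,T^{c_1n}f_1\cdots T^{c_sn}f_s\Big\|_{L^2(\mu)}\le C\,\min\big\{\|f_i\|_{U^{s+1}(X,\mu,T)} : 1\le i\le s\big\}.$$ Here $T^nf=f\circ T^n$. A Følner sequence in $\mathbb N$ is a sequence of nonempty finite sets $\Phi_N\subseteq\mathbb N$ such that $|\Phi_N\,\triangle\,(\Phi_N+k)|/|\Phi_N|\to 0$ for every $k\in\mathbb N$. The uniformity seminorms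 are defined for $f\in L^\infty(\mu)$ by $\|f\|_{U^0(X,\mu,T)}=\int_X f\,d\mu$ and, for $s\ge0$, $$\|f\|_{U^{s+1}(X,\mu,T)}=\lim_{H\to\infty}\Big(\frac1H\sum_{h=0}^{H-1}\big\|T^hf\cdot\overline f\big\|_{U^s(X,\mu,T)}^{2^s}\Big)^{1/2^{s+1}}.$$ -/

import Mathlib

open MeasureTheory Filter Topology
open scoped ENNReal

noncomputable section

/-- `Φ` is a Følner sequence in the natural numbers: a sequence of nonempty finite sets with
`|Φ_N ∆ (Φ_N + k)| / |Φ_N| → 0` for every `k`. -/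
def IsFolnerSeq (Φ : ℕ → Finset ℕ) : Prop :=
  (∀ N, (Φ N).Nonempty) ∧
    ∀ k : ℕ, Tendsto
      (fun N => ((symmDiff (Φ N) ((Φ N).image (fun n => n + k))).card : ℝ) / ((Φ N).card : ℝ))
      atTop (𝓝 0)

/-- The uniformity (Host-Kra) seminorms `‖f‖_{U^s(X, μ, T)}`, defined by `‖f‖_{U^0} = ∫ f dμ` and
`‖f‖_{U^{s+1}} = lim_H ((1/H) ∑_{h < H} ‖T^h f · conj f‖_{U^s} ^ (2^s)) ^ (1 / 2^(s+1))`,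
where `T^h f = f ∘ T^h`. Only the case `s = 0` can give a non-real number; its real part is taken
here, which does not affect `U^s` for `s ≥ 1`, since the averages of `∫ T^h f · conj f dμ`
converge to a nonnegative real number. -/
def uniformitySeminorm {X : Type*} [MeasurableSpace X] (μ : Measure X) (T : X → X) :
    ℕ → (X → ℂ) → ℝ
  | 0, f => (∫ x, f x ∂μ).re
  | s + 1, f =>
      limUnder atTop fun H : ℕ =>
        ((1 / (H : ℝ)) * ∑ h ∈ Finset.range H,
          (uniformitySeminorm μ T s (fun x => f (T^[h] x) * (starRingEnd ℂ) (f x))) ^ (2 ^ s)) ^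
            ((1 : ℝ) / 2 ^ (s + 1))

/-- The weighted multiple ergodic average
`(1/|A|) ∑_{n ∈ A} b_n T^{c_1 n} f_1 ⋯ T^{c_s n} f_s`, as a function on `X`. -/
def weightedErgodicAverage {X : Type*} (T : X → X) {s : ℕ} (c : Fin s → ℕ) (b : ℕ → ℂ)
    (f : Fin s → X → ℂ) (A : Finset ℕ) : X → ℂ :=
  fun x => (1 / (A.card : ℂ)) * ∑ n ∈ A, b n * ∏ i : Fin s, f i (T^[c i * n] x)

end

-- Call the integrals `∫ ∏ f_i(T^{c_i n} x)` correlations. Bounds for correlations and bounds for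
-- averages in `L²` feed each other.
--
-- From correlations to averages (`CorrelationBound.averageBound`): `vanDerCorput` bounds the
-- average of `s` functions by correlations, over lags `d`, of the derivatives `conj(T^{c_i d} f_i)
-- · f_i`. The weights become `conj(b_{n+d}) b_n`, still bounded by one. If these correlations are
-- controlled by `U^s` of the `j`-th derivative, averaging over `d` gives `U^{s+1}` of `f_j` by the
-- recursive definition, up to a power mean inequality and a factor paying for the lags being
-- multiples of `|c_j|`.
--
-- From averages to correlations (`AverageBound.correlationBound`): for `i ≠ j`, translate by
-- `T^{-c_i n}` and remove `f_i` by Cauchy–Schwarz. What remains is an average of one function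
-- fewer, with exponents `c_l - c_i`: distinct and nonzero, but possibly negative, whence integer
-- exponents. The induction starts from `|∫ f| ≤ ‖f‖_{U^1}`.
--
-- The limits defining the seminorms must also be shown to exist (`cubeForm_spec`). The mean ergodic
-- theorem gives level one for any invariant state. Level `k + 1` of a state is level `k` of a
-- doubled state on `Y × Y`, at `F ⊗ conj F`. Finite additivity suffices, so an ultrafilter limit
-- replaces the construction of cube measures.

universe u

/-! ### Mean ergodic theorem in a semi-inner product space -/

/-- A form of the mean ergodic theorem for a contraction of a semi-inner product space: the
averages of `re ⟪x, U^h x⟫` and the squared norms of the averages of `U^h x` have a common limit. -/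
theorem exists_tendsto_average_inner {E : Type*} [SeminormedAddCommGroup E]
    [InnerProductSpace ℂ E] (U : E →ₗ[ℂ] E) (hU : ∀ x, ‖U x‖ ≤ ‖x‖) (x : E) :
    ∃ L : ℝ, Tendsto (fun H : ℕ => (1 / (H : ℝ)) *
        ∑ h ∈ Finset.range H, (inner ℂ x (U^[h] x)).re) atTop (𝓝 L) ∧
      Tendsto (fun H : ℕ => ‖((H : ℂ)⁻¹) • ∑ h ∈ Finset.range H, U^[h] x‖ ^ 2) atTop (𝓝 L) := by
  -- The mean ergodic theorem needs a Hilbert space; the completion supplies completeness and kills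
  -- the null vectors. The common limit is `‖Px‖²`, with `P` the projection onto the fixed vectors.
  let V : E →L[ℂ] E := U.mkContinuous 1 (by simpa using hU)
  let W : UniformSpace.Completion E →L[ℂ] UniformSpace.Completion E := V.completion
  have hW : ∀ y : E, W (y : UniformSpace.Completion E) = ((U y : E) : UniformSpace.Completion E) :=
    fun y => UniformSpace.Completion.map_coe V.uniformContinuous y
  have hWn : ‖W‖ ≤ 1 := by
    refine ContinuousLinearMap.opNorm_le_bound _ zero_le_one fun z => ?_
    rw [one_mul]
    refine UniformSpace.Completion.induction_on z (isClosed_le (by fun_prop) (by fun_prop)) ?_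
    intro a
    rw [hW, UniformSpace.Completion.norm_coe, UniformSpace.Completion.norm_coe]
    exact hU a
  have hWi : ∀ h : ℕ, W^[h] (x : UniformSpace.Completion E) =
      ((U^[h] x : E) : UniformSpace.Completion E) := by
    intro h
    induction h with
    | zero => rfl
    | succ k ih => rw [Function.iterate_succ_apply', Function.iterate_succ_apply', ih, hW]
  have key := W.tendsto_birkhoffAverage_orthogonalProjection hWn x
  set p := (W.eqLocus (1 : UniformSpace.Completion E →L[ℂ] UniformSpace.Completion E))
  have hb : ∀ H : ℕ, birkhoffAverage ℂ W _root_.id H (x : UniformSpace.Completion E) =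
      ((((H : ℂ)⁻¹) • ∑ h ∈ Finset.range H, U^[h] x : E) : UniformSpace.Completion E) := by
    intro H
    simp only [birkhoffAverage, birkhoffSum, id, hWi]
    rw [UniformSpace.Completion.coe_smul]
    congr 1
    exact (map_sum (UniformSpace.Completion.toCompl (α := E)) _ _).symm
  simp only [hb] at key
  refine ⟨‖(p.orthogonalProjectionOnto (x : UniformSpace.Completion E) :
    UniformSpace.Completion E)‖ ^ 2, ?_, ?_⟩
  · have h1 := (Complex.continuous_re.tendsto _).comp
      ((tendsto_const_nhds (x := (x : UniformSpace.Completion E))).inner key (𝕜 := ℂ))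
    have h2 : (inner ℂ (x : UniformSpace.Completion E)
        (p.orthogonalProjectionOnto (x : UniformSpace.Completion E) :
          UniformSpace.Completion E)).re = ‖(p.orthogonalProjectionOnto
            (x : UniformSpace.Completion E) : UniformSpace.Completion E)‖ ^ 2 := by
      have h3 : inner ℂ ((x : UniformSpace.Completion E) - p.orthogonalProjectionOnto
          (x : UniformSpace.Completion E)) (p.orthogonalProjectionOnto
            (x : UniformSpace.Completion E) : UniformSpace.Completion E) = 0 :=
        p.sub_starProjection_mem_orthogonal (x : UniformSpace.Completion E) |> fun h =>
          (Submodule.mem_orthogonal' _ _).1 h _ (Submodule.coe_mem _)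
      rw [inner_sub_left, sub_eq_zero] at h3
      rw [h3, inner_self_eq_norm_sq_to_K]
      norm_cast
    rw [h2] at h1
    refine h1.congr fun H => ?_
    simp only [Function.comp, UniformSpace.Completion.inner_coe, inner_smul_right, inner_sum]
    rw [← Complex.ofReal_natCast, ← Complex.ofReal_inv, Complex.re_ofReal_mul, Complex.re_sum,
      one_div]
  · have h1 := key.norm.pow 2
    refine h1.congr fun H => ?_
    rw [UniformSpace.Completion.norm_coe]

/-! ### Bounded measurable functions and invariant states -/

/-- The bounded measurable complex functions, as a submodule of all functions. -/
def boundedMeasurable (Y : Type*) [MeasurableSpace Y] : Submodule ℂ (Y → ℂ) where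
  carrier := {F | Measurable F ∧ ∃ M : ℝ, ∀ y, ‖F y‖ ≤ M}
  add_mem' := by
    rintro F G ⟨hF, M, hM⟩ ⟨hG, K, hK⟩
    exact ⟨hF.add hG, M + K, fun y => (norm_add_le _ _).trans (add_le_add (hM y) (hK y))⟩
  zero_mem' := ⟨measurable_const, 0, fun y => by simp⟩
  smul_mem' := by
    rintro c F ⟨hF, M, hM⟩
    refine ⟨hF.const_smul c, ‖c‖ * M, fun y => ?_⟩
    rw [Pi.smul_apply, norm_smul]
    exact mul_le_mul_of_nonneg_left (hM y) (norm_nonneg c)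

section BoundedMeasurable

variable {Y Z : Type*} [MeasurableSpace Y] [MeasurableSpace Z] {F G : Y → ℂ}

theorem boundedMeasurable.mul (hF : F ∈ boundedMeasurable Y) (hG : G ∈ boundedMeasurable Y) :
    (fun y => F y * G y) ∈ boundedMeasurable Y := by
  obtain ⟨hF, M, hM⟩ := hF
  obtain ⟨hG, K, hK⟩ := hG
  refine ⟨hF.mul hG, M * K, fun y => ?_⟩
  rw [norm_mul]
  exact mul_le_mul (hM y) (hK y) (norm_nonneg _) ((norm_nonneg _).trans (hM y))

theorem boundedMeasurable.conj (hF : F ∈ boundedMeasurable Y) :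
    (fun y => (starRingEnd ℂ) (F y)) ∈ boundedMeasurable Y := by
  obtain ⟨hF, M, hM⟩ := hF
  exact ⟨Complex.continuous_conj.measurable.comp hF, M, fun y => by simpa using hM y⟩

theorem boundedMeasurable.comp (hF : F ∈ boundedMeasurable Y) {R : Z → Y} (hR : Measurable R) :
    (fun z => F (R z)) ∈ boundedMeasurable Z :=
  ⟨hF.1.comp hR, hF.2.imp fun _ h z => h (R z)⟩

theorem boundedMeasurable.exists_nonneg_bound (hF : F ∈ boundedMeasurable Y) :
    ∃ M : ℝ, 0 ≤ M ∧ ∀ y, ‖F y‖ ≤ M := by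
  obtain ⟨-, M, hM⟩ := hF
  exact ⟨max M 0, le_max_right _ _, fun y => (hM y).trans (le_max_left _ _)⟩

/-- The multiplicative derivative `S^h F · conj F`. -/
theorem boundedMeasurable.shift_mul_conj (hF : F ∈ boundedMeasurable Y) {S : Y → Y}
    (hS : Measurable S) (h : ℕ) :
    (fun y => F (S^[h] y) * (starRingEnd ℂ) (F y)) ∈ boundedMeasurable Y :=
  boundedMeasurable.mul (boundedMeasurable.comp hF (hS.iterate h)) (boundedMeasurable.conj hF)

end BoundedMeasurable

/-- A state on the bounded measurable functions, invariant under `S`. -/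
structure IsInvariantState {Y : Type*} [MeasurableSpace Y] (S : Y → Y) (φ : (Y → ℂ) → ℂ) :
    Prop where
  meas : Measurable S
  add : ∀ F ∈ boundedMeasurable Y, ∀ G ∈ boundedMeasurable Y,
    φ (fun y => F y + G y) = φ F + φ G
  smul : ∀ c : ℂ, ∀ F ∈ boundedMeasurable Y, φ (fun y => c * F y) = c * φ F
  conj : ∀ F ∈ boundedMeasurable Y, φ (fun y => (starRingEnd ℂ) (F y)) = (starRingEnd ℂ) (φ F)
  nonneg : ∀ F ∈ boundedMeasurable Y, 0 ≤ (φ (fun y => (starRingEnd ℂ) (F y) * F y)).re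
  bound : ∀ F ∈ boundedMeasurable Y, ∀ M : ℝ, 0 ≤ M → (∀ y, ‖F y‖ ≤ M) → ‖φ F‖ ≤ M
  inv : ∀ F ∈ boundedMeasurable Y, φ (fun y => F (S y)) = φ F

namespace IsInvariantState

variable {Y : Type*} [MeasurableSpace Y] {S : Y → Y} {φ : (Y → ℂ) → ℂ}

/-- The semi-inner product `⟪F, G⟫ = φ (conj F · G)`. -/
@[reducible] def core (hφ : IsInvariantState S φ) :
    PreInnerProductSpace.Core ℂ (boundedMeasurable Y) where
  inner F G := φ (fun y => (starRingEnd ℂ) (F.1 y) * G.1 y)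
  conj_inner_symm F G := by
    rw [← hφ.conj _ (boundedMeasurable.mul (boundedMeasurable.conj G.2) F.2)]
    congr 1
    ext y
    simp [mul_comm]
  re_inner_nonneg F := hφ.nonneg _ F.2
  add_left F G K := by
    rw [← hφ.add _ (boundedMeasurable.mul (boundedMeasurable.conj F.2) K.2)
      _ (boundedMeasurable.mul (boundedMeasurable.conj G.2) K.2)]
    congr 1
    ext y
    simp [add_mul]
  smul_left F G c := by
    rw [← hφ.smul _ _ (boundedMeasurable.mul (boundedMeasurable.conj F.2) G.2)]
    congr 1
    ext y
    simp [mul_assoc]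

/-- The Koopman operator of `S` on bounded measurable functions. -/
def koopman (hφ : IsInvariantState S φ) : boundedMeasurable Y →ₗ[ℂ] boundedMeasurable Y where
  toFun F := ⟨fun y => F.1 (S y), boundedMeasurable.comp F.2 hφ.meas⟩
  map_add' _ _ := rfl
  map_smul' _ _ := rfl

theorem koopman_iterate (hφ : IsInvariantState S φ) (F : boundedMeasurable Y) (h : ℕ) :
    (hφ.koopman^[h] F).1 = fun y => F.1 (S^[h] y) := by
  induction h with
  | zero => rfl
  | succ k ih =>
    rw [Function.iterate_succ_apply']
    ext y
    change (hφ.koopman^[k] F).1 (S y) = _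
    rw [ih, Function.iterate_succ_apply]

/-- The Koopman operator is isometric for the semi-inner product of `φ`, so the mean ergodic theorem
applies. The lower bound on `L` is Cauchy–Schwarz against the constant `1`, whose inner product with
every average is `φ F`. -/
theorem exists_tendsto_average (hφ : IsInvariantState S φ) {F : Y → ℂ}
    (hF : F ∈ boundedMeasurable Y) :
    ∃ L : ℝ, Tendsto (fun H : ℕ => (1 / (H : ℝ)) * ∑ h ∈ Finset.range H,
        (φ (fun y => F (S^[h] y) * (starRingEnd ℂ) (F y))).re) atTop (𝓝 L) ∧
      ‖φ F‖ ^ 2 ≤ L := by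
  let c : PreInnerProductSpace.Core ℂ (boundedMeasurable Y) := hφ.core
  let : SeminormedAddCommGroup (boundedMeasurable Y) :=
    InnerProductSpace.Core.toSeminormedAddCommGroup (𝕜 := ℂ)
  let : InnerProductSpace ℂ (boundedMeasurable Y) := InnerProductSpace.ofCore c
  have hin : ∀ A B : boundedMeasurable Y,
    inner ℂ A B = φ (fun y => (starRingEnd ℂ) (A.1 y) * B.1 y) := fun _ _ => rfl
  have hnorm : ∀ A : boundedMeasurable Y,
      ‖A‖ ^ 2 = (φ (fun y => (starRingEnd ℂ) (A.1 y) * A.1 y)).re := by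
    intro A
    rw [← hin, ← inner_self_eq_norm_sq (𝕜 := ℂ)]
    rfl
  have hU : ∀ A, ‖hφ.koopman A‖ ≤ ‖A‖ := by
    intro A
    refine le_of_eq ((sq_eq_sq₀ (norm_nonneg _) (norm_nonneg _)).1 ?_)
    rw [hnorm, hnorm]
    exact congrArg Complex.re
      (hφ.inv _ (boundedMeasurable.mul (boundedMeasurable.conj A.2) A.2))
  obtain ⟨L, h1, h2⟩ := exists_tendsto_average_inner hφ.koopman hU ⟨F, hF⟩
  have hterm : ∀ h : ℕ, inner ℂ (⟨F, hF⟩ : boundedMeasurable Y) (hφ.koopman^[h] ⟨F, hF⟩) =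
      φ (fun y => F (S^[h] y) * (starRingEnd ℂ) (F y)) := by
    intro h
    rw [hin, hφ.koopman_iterate]
    congr 1
    ext y
    exact mul_comm _ _
  refine ⟨L, by simpa only [hterm] using h1, ?_⟩
  refine ge_of_tendsto h2 ?_
  filter_upwards [eventually_gt_atTop 0] with H hH
  let e : boundedMeasurable Y := ⟨fun _ => 1, measurable_const, 1, fun y => by simp⟩
  have he : ‖e‖ ≤ 1 := by
    have h3 : ‖e‖ ^ 2 ≤ 1 := by
      rw [hnorm]
      refine (Complex.re_le_norm _).trans (hφ.bound _ ?_ 1 zero_le_one fun y => by simp [e])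
      exact boundedMeasurable.mul (boundedMeasurable.conj e.2) e.2
    nlinarith [norm_nonneg e]
  have hFi : ∀ h : ℕ, inner ℂ e (hφ.koopman^[h] ⟨F, hF⟩) = φ F := by
    intro h
    rw [hin, hφ.koopman_iterate]
    have h3 : ∀ k : ℕ, φ (fun y => F (S^[k] y)) = φ F := by
      intro k
      induction k with
      | zero => rfl
      | succ k ih =>
        rw [← ih]
        exact hφ.inv (fun y => F (S^[k] y)) (boundedMeasurable.comp hF (hφ.meas.iterate k))
    rw [← h3 h]
    congr 1
    ext y
    simp [e]
  have h4 : inner ℂ e (((H : ℂ)⁻¹) • ∑ h ∈ Finset.range H, hφ.koopman^[h] ⟨F, hF⟩) = φ F := by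
    rw [inner_smul_right, inner_sum, Finset.sum_congr rfl fun h _ => hFi h]
    have : (H : ℂ) ≠ 0 := by exact_mod_cast hH.ne'
    simp [this]
  have h5 := norm_inner_le_norm (𝕜 := ℂ) e
    (((H : ℂ)⁻¹) • ∑ h ∈ Finset.range H, hφ.koopman^[h] ⟨F, hF⟩)
  rw [h4] at h5
  refine pow_le_pow_left₀ (norm_nonneg _) (h5.trans ?_) 2
  exact mul_le_of_le_one_left (norm_nonneg _) he

end IsInvariantState

/-! ### Doubling a state along an ultrafilter -/

/-- The averages `(1/H) ∑_{h < H} a_h`. -/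
noncomputable def cesaro {K : Type*} [DivisionRing K] (a : ℕ → K) (H : ℕ) : K :=
  (1 / (H : K)) * ∑ h ∈ Finset.range H, a h

theorem norm_cesaro_le {a : ℕ → ℂ} {M : ℝ} (hM : 0 ≤ M) (ha : ∀ h, ‖a h‖ ≤ M) (H : ℕ) :
    ‖cesaro a H‖ ≤ M := by
  unfold cesaro
  rcases Nat.eq_zero_or_pos H with rfl | hH
  · simpa using hM
  · have h1 : ‖∑ h ∈ Finset.range H, a h‖ ≤ H * M :=
      (norm_sum_le _ _).trans ((Finset.sum_le_sum fun h _ => ha h).trans_eq (by simp))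
    have hH' : (0 : ℝ) < H := by exact_mod_cast hH
    rw [norm_mul, norm_div, norm_one, Complex.norm_natCast, div_mul_eq_mul_div, one_mul,
      div_le_iff₀ hH', mul_comm M]
    exact h1

/-- The limit along a fixed ultrafilter of the averages of a sequence. -/
noncomputable def ultraMean (a : ℕ → ℂ) : ℂ :=
  limUnder (hyperfilter ℕ : Filter ℕ) (cesaro a)

theorem tendsto_ultraMean {a : ℕ → ℂ} {M : ℝ} (hM : 0 ≤ M) (ha : ∀ h, ‖a h‖ ≤ M) :
    Tendsto (cesaro a) (hyperfilter ℕ : Filter ℕ) (𝓝 (ultraMean a)) := by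
  have hc : IsCompact (Metric.closedBall (0 : ℂ) M) := isCompact_closedBall _ _
  obtain ⟨z, -, hz⟩ := hc.ultrafilter_le_nhds ((hyperfilter ℕ).map (cesaro a)) (by
    rw [Ultrafilter.coe_map, le_principal_iff]
    refine Filter.mem_map.2 (Filter.univ_mem' fun H => ?_)
    simpa using norm_cesaro_le hM ha H)
  exact tendsto_nhds_limUnder ⟨z, hz⟩

/-- The functional `F ↦ lim_H (1/H) ∑_{h < H} φ (y ↦ F (S^h y, y))` on functions on `Y × Y`. -/
noncomputable def doubled {Y : Type*} (φ : (Y → ℂ) → ℂ) (S : Y → Y) (F : Y × Y → ℂ) : ℂ :=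
  ultraMean fun h => φ fun y => F (S^[h] y, y)

namespace IsInvariantState

variable {Y : Type*} [MeasurableSpace Y] {S : Y → Y} {φ : (Y → ℂ) → ℂ}

theorem measurable_graph (hφ : IsInvariantState S φ) (h : ℕ) :
    Measurable fun y => (S^[h] y, y) :=
  (hφ.meas.iterate h).prodMk measurable_id

theorem tendsto_doubled (hφ : IsInvariantState S φ) {F : Y × Y → ℂ}
    (hF : F ∈ boundedMeasurable (Y × Y)) :
    Tendsto (cesaro fun h => φ fun y => F (S^[h] y, y)) (hyperfilter ℕ : Filter ℕ)
      (𝓝 (doubled φ S F)) := by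
  obtain ⟨M, hM, hb⟩ := boundedMeasurable.exists_nonneg_bound hF
  exact tendsto_ultraMean hM fun h =>
    hφ.bound _ (boundedMeasurable.comp hF (hφ.measurable_graph h)) M hM fun y => hb _

/-- Every axiom survives averages and ultrafilter limits. Invariance already holds for each `h`:
with `G y = F (S^h y, y)`, composing `F` with `S × S` turns `G` into `G ∘ S`. -/
theorem doubled_state (hφ : IsInvariantState S φ) :
    IsInvariantState (Prod.map S S) (doubled φ S) where
  meas := hφ.meas.prodMap hφ.meas
  add F hF G hG := by
    refine tendsto_nhds_unique (hφ.tendsto_doubled (Submodule.add_mem _ hF hG))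
      (((hφ.tendsto_doubled hF).add (hφ.tendsto_doubled hG)).congr fun H => ?_)
    unfold cesaro
    rw [← mul_add, ← Finset.sum_add_distrib]
    congr 1
    refine Finset.sum_congr rfl fun h _ => ?_
    exact (hφ.add _ (boundedMeasurable.comp hF (hφ.measurable_graph h))
      _ (boundedMeasurable.comp hG (hφ.measurable_graph h))).symm
  smul c F hF := by
    refine tendsto_nhds_unique (hφ.tendsto_doubled (Submodule.smul_mem _ c hF))
      (((hφ.tendsto_doubled hF).const_mul c).congr fun H => ?_)
    unfold cesaro
    rw [mul_left_comm, Finset.mul_sum]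
    congr 1
    refine Finset.sum_congr rfl fun h _ => ?_
    exact (hφ.smul c _ (boundedMeasurable.comp hF (hφ.measurable_graph h))).symm
  conj F hF := by
    refine tendsto_nhds_unique (hφ.tendsto_doubled (boundedMeasurable.conj hF))
      (((Complex.continuous_conj.tendsto _).comp (hφ.tendsto_doubled hF)).congr fun H => ?_)
    simp only [Function.comp, cesaro, map_mul, map_sum, map_div₀, map_one, map_natCast]
    congr 1
    refine Finset.sum_congr rfl fun h _ => ?_
    exact (hφ.conj _ (boundedMeasurable.comp hF (hφ.measurable_graph h))).symm
  nonneg F hF := by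
    refine ge_of_tendsto ((Complex.continuous_re.tendsto _).comp (hφ.tendsto_doubled
      (boundedMeasurable.mul (boundedMeasurable.conj hF) hF)))
      (Filter.Eventually.of_forall fun H => ?_)
    have : (1 / (H : ℂ)) = ((1 / (H : ℝ) : ℝ) : ℂ) := by push_cast; rfl
    simp only [Function.comp, cesaro]
    rw [this, Complex.re_ofReal_mul, Complex.re_sum]
    exact mul_nonneg (by positivity) (Finset.sum_nonneg fun h _ =>
      hφ.nonneg _ (boundedMeasurable.comp hF (hφ.measurable_graph h)))
  bound F hF M hM hb := by
    refine le_of_tendsto (hφ.tendsto_doubled hF).norm (Filter.Eventually.of_forall fun H => ?_)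
    exact norm_cesaro_le hM (fun h =>
      hφ.bound _ (boundedMeasurable.comp hF (hφ.measurable_graph h)) M hM fun y => hb _) H
  inv F hF := by
    unfold doubled
    congr 1
    ext h
    rw [← hφ.inv _ (boundedMeasurable.comp hF (hφ.measurable_graph h))]
    congr 1
    ext y
    simp only [Prod.map]
    rw [← Function.iterate_succ_apply' S, Function.iterate_succ_apply]

end IsInvariantState

/-! ### Existence of the iterated limits -/

/-- The iterated averages `‖F‖_{U^k}^{2^k}` attached to a functional `φ`. -/
noncomputable def cubeForm {Y : Type*} (φ : (Y → ℂ) → ℂ) (S : Y → Y) : ℕ → (Y → ℂ) → ℝ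
  | 0, F => (φ F).re
  | k + 1, F => limUnder atTop
      (cesaro fun h => cubeForm φ S k fun y => F (S^[h] y) * (starRingEnd ℂ) (F y))

/-- The function `F ⊗ conj F`. -/
def conjTensor {Y : Type*} (F : Y → ℂ) : Y × Y → ℂ := fun z => F z.1 * (starRingEnd ℂ) (F z.2)

theorem boundedMeasurable.conjTensor_mem {Y : Type*} [MeasurableSpace Y] {F : Y → ℂ}
    (hF : F ∈ boundedMeasurable Y) : conjTensor F ∈ boundedMeasurable (Y × Y) :=
  boundedMeasurable.mul (boundedMeasurable.comp hF measurable_fst)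
    (boundedMeasurable.conj (boundedMeasurable.comp hF measurable_snd))

theorem conjTensor_shift_mul_conj {Y : Type*} (F : Y → ℂ) (S : Y → Y) (h : ℕ) :
    conjTensor (fun y => F (S^[h] y) * (starRingEnd ℂ) (F y)) =
      fun z => conjTensor F ((Prod.map S S)^[h] z) * (starRingEnd ℂ) (conjTensor F z) := by
  ext z
  simp only [conjTensor, Prod.map_iterate, Prod.map, map_mul, Complex.conj_conj]
  ring

/-- Tensoring commutes with the multiplicative derivative, so the averages at one level are those
one level lower for the doubled state. The system is quantified inside the induction because the
step passes from `Y` to `Y × Y`. The ergodic theorem enters only at `k = 0`, where the genuine limit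
must agree with the ultrafilter limit. -/
theorem cubeForm_spec (k : ℕ) : ∀ {Y : Type*} [MeasurableSpace Y] {S : Y → Y}
    {φ : (Y → ℂ) → ℂ}, IsInvariantState S φ → ∀ F ∈ boundedMeasurable Y,
    Tendsto (cesaro fun h => cubeForm φ S k fun y => F (S^[h] y) * (starRingEnd ℂ) (F y)) atTop
        (𝓝 (cubeForm φ S (k + 1) F)) ∧
      0 ≤ cubeForm φ S (k + 1) F ∧
      cubeForm φ S (k + 1) F = cubeForm (doubled φ S) (Prod.map S S) k (conjTensor F) := by
  induction k with
  | zero =>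
    intro Y _ S φ hφ F hF
    obtain ⟨L, hL, hL0⟩ := hφ.exists_tendsto_average hF
    have h1 : Tendsto (cesaro fun h => cubeForm φ S 0
        fun y => F (S^[h] y) * (starRingEnd ℂ) (F y)) atTop (𝓝 L) := hL
    have h2 : cubeForm φ S 1 F = L := h1.limUnder_eq
    refine ⟨h2 ▸ h1, h2 ▸ (sq_nonneg _).trans hL0, ?_⟩
    rw [h2]
    refine tendsto_nhds_unique (h1.mono_left Nat.hyperfilter_le_atTop)
      (((Complex.continuous_re.tendsto _).comp (hφ.tendsto_doubled
        (boundedMeasurable.conjTensor_mem hF))).congr fun H => ?_)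
    have : (1 / (H : ℂ)) = ((1 / (H : ℝ) : ℝ) : ℂ) := by push_cast; rfl
    simp only [Function.comp, cesaro]
    rw [this, Complex.re_ofReal_mul, Complex.re_sum]
    rfl
  | succ k ih =>
    intro Y _ S φ hφ F hF
    obtain ⟨h1, h2, -⟩ := ih hφ.doubled_state _ (boundedMeasurable.conjTensor_mem hF)
    have h3 : ∀ h : ℕ, cubeForm φ S (k + 1) (fun y => F (S^[h] y) * (starRingEnd ℂ) (F y)) =
        cubeForm (doubled φ S) (Prod.map S S) k (fun z =>
          conjTensor F ((Prod.map S S)^[h] z) * (starRingEnd ℂ) (conjTensor F z)) := by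
      intro h
      rw [(ih hφ _ (boundedMeasurable.shift_mul_conj hF hφ.meas h)).2.2,
        conjTensor_shift_mul_conj]
    simp only [← h3] at h1
    have h4 : cubeForm φ S (k + 1 + 1) F =
      cubeForm (doubled φ S) (Prod.map S S) (k + 1) (conjTensor F) := h1.limUnder_eq
    exact ⟨h4 ▸ h1, h4 ▸ h2, h4⟩

/-! ### Uniformity seminorms of a measure preserving system -/

section Seminorm

variable {X : Type*} [MeasurableSpace X] {μ : Measure X}

theorem integrable_of_boundedMeasurable [IsFiniteMeasure μ] {F : X → ℂ}
    (hF : F ∈ boundedMeasurable X) : Integrable F μ := by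
  obtain ⟨hF, M, hM⟩ := hF
  exact Integrable.of_bound hF.aestronglyMeasurable M (Eventually.of_forall hM)

theorem isInvariantState_integral [IsProbabilityMeasure μ] {T : X ≃ᵐ X}
    (hT : MeasurePreserving T μ μ) : IsInvariantState T (fun F => ∫ x, F x ∂μ) where
  meas := T.measurable
  add F hF G hG :=
    integral_add (integrable_of_boundedMeasurable hF) (integrable_of_boundedMeasurable hG)
  smul c F _ := integral_const_mul c F
  conj F _ := integral_conj
  nonneg F hF := by
    have : ∀ x, (starRingEnd ℂ) (F x) * F x = ((‖F x‖ ^ 2 : ℝ) : ℂ) := fun x => by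
      rw [mul_comm, Complex.mul_conj, Complex.normSq_eq_norm_sq]
    simp only [this]
    rw [integral_complex_ofReal, Complex.ofReal_re]
    exact integral_nonneg fun x => sq_nonneg _
  bound F _ M _ hM := by
    refine (norm_integral_le_of_norm_le_const (Eventually.of_forall hM)).trans_eq ?_
    simp
  inv F _ := hT.integral_comp' F

variable [IsProbabilityMeasure μ] {T : X ≃ᵐ X}

/-- Taking the root and then the power `2^k` is harmless only because the cube form is nonnegative
from level one on. At level zero the power is `1` and the value may be negative, so the sign is
claimed at `k + 1`. -/
theorem uniformitySeminorm_succ_spec (hT : MeasurePreserving T μ μ) (k : ℕ) :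
    ∀ F ∈ boundedMeasurable X,
      uniformitySeminorm μ T k F ^ 2 ^ k = cubeForm (fun F => ∫ x, F x ∂μ) T k F ∧
      0 ≤ uniformitySeminorm μ T (k + 1) F := by
  have hφ := isInvariantState_integral hT
  induction k with
  | zero =>
    intro F hF
    refine ⟨by simp [uniformitySeminorm, cubeForm], ?_⟩
    obtain ⟨h1, h2, -⟩ := cubeForm_spec 0 hφ F hF
    have h3 : uniformitySeminorm μ T (0 + 1) F =
        cubeForm (fun F => ∫ x, F x ∂μ) T (0 + 1) F ^ ((1 : ℝ) / 2 ^ (0 + 1)) := by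
      refine Tendsto.limUnder_eq ((h1.rpow_const (Or.inr (by positivity))).congr fun H => ?_)
      simp [uniformitySeminorm, cubeForm, cesaro]
    rw [h3]
    exact Real.rpow_nonneg h2 _
  | succ k ih =>
    have key : ∀ F ∈ boundedMeasurable X, uniformitySeminorm μ T (k + 1) F =
        cubeForm (fun F => ∫ x, F x ∂μ) T (k + 1) F ^ ((1 : ℝ) / 2 ^ (k + 1)) := by
      intro F hF
      obtain ⟨h1, h2, -⟩ := cubeForm_spec k hφ F hF
      refine Tendsto.limUnder_eq ((h1.rpow_const (Or.inr (by positivity))).congr fun H => ?_)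
      simp only [cesaro, fun h => (ih _ (boundedMeasurable.shift_mul_conj hF T.measurable h)).1]
    have key2 : ∀ F ∈ boundedMeasurable X, uniformitySeminorm μ T (k + 1) F ^ 2 ^ (k + 1) =
        cubeForm (fun F => ∫ x, F x ∂μ) T (k + 1) F := by
      intro F hF
      rw [key F hF, ← Real.rpow_natCast, ← Real.rpow_mul (cubeForm_spec k hφ F hF).2.1]
      simp
    intro F hF
    refine ⟨key2 F hF, ?_⟩
    obtain ⟨h1, h2, -⟩ := cubeForm_spec (k + 1) hφ F hF
    have h3 : uniformitySeminorm μ T (k + 1 + 1) F =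
        cubeForm (fun F => ∫ x, F x ∂μ) T (k + 1 + 1) F ^ ((1 : ℝ) / 2 ^ (k + 1 + 1)) := by
      refine Tendsto.limUnder_eq ((h1.rpow_const (Or.inr (by positivity))).congr fun H => ?_)
      simp only [cesaro, fun h => key2 _ (boundedMeasurable.shift_mul_conj hF T.measurable h)]
    rw [h3]
    exact Real.rpow_nonneg h2 _

theorem uniformitySeminorm_nonneg (hT : MeasurePreserving T μ μ) (k : ℕ) {F : X → ℂ}
    (hF : F ∈ boundedMeasurable X) : 0 ≤ uniformitySeminorm μ T (k + 1) F :=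
  (uniformitySeminorm_succ_spec hT k F hF).2

/-- The limit defining the uniformity seminorms exists. -/
theorem tendsto_uniformitySeminorm (hT : MeasurePreserving T μ μ) (k : ℕ) {F : X → ℂ}
    (hF : F ∈ boundedMeasurable X) :
    Tendsto (fun H : ℕ => (1 / (H : ℝ)) * ∑ h ∈ Finset.range H,
        uniformitySeminorm μ T k (fun x => F (T^[h] x) * (starRingEnd ℂ) (F x)) ^ 2 ^ k) atTop
      (𝓝 (uniformitySeminorm μ T (k + 1) F ^ 2 ^ (k + 1))) := by
  have hφ := isInvariantState_integral hT
  rw [(uniformitySeminorm_succ_spec hT (k + 1) F hF).1]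
  refine (cubeForm_spec k hφ F hF).1.congr fun H => ?_
  simp only [cesaro, fun h => (uniformitySeminorm_succ_spec hT k _
    (boundedMeasurable.shift_mul_conj hF T.measurable h)).1]

/-- The limit bounding `‖φ F‖²` for an invariant state is here the square of the `U^1` seminorm. -/
theorem norm_integral_le_uniformitySeminorm (hT : MeasurePreserving T μ μ) {F : X → ℂ}
    (hF : F ∈ boundedMeasurable X) : ‖∫ x, F x ∂μ‖ ≤ uniformitySeminorm μ T 1 F := by
  obtain ⟨L, h1, h2⟩ := (isInvariantState_integral hT).exists_tendsto_average hF
  have h3 := (tendsto_uniformitySeminorm hT 0 hF).congr fun H => by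
    simp only [uniformitySeminorm, pow_zero, pow_one]; rfl
  rw [tendsto_nhds_unique h1 h3] at h2
  exact (sq_le_sq₀ (norm_nonneg _) (uniformitySeminorm_nonneg hT 0 hF)).1 h2

end Seminorm

theorem uniformitySeminorm_comp {X : Type*} [MeasurableSpace X] {μ : Measure X} {T : X ≃ᵐ X}
    (hT : MeasurePreserving T μ μ) (k : ℕ) :
    ∀ F : X → ℂ, uniformitySeminorm μ T k (fun x => F (T x)) = uniformitySeminorm μ T k F := by
  induction k with
  | zero => exact fun F => congrArg Complex.re (hT.integral_comp' F)
  | succ k ih =>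
    intro F
    simp only [uniformitySeminorm]
    have h1 : ∀ h : ℕ, uniformitySeminorm μ T k
        (fun x => F (T (T^[h] x)) * (starRingEnd ℂ) (F (T x))) =
        uniformitySeminorm μ T k (fun x => F (T^[h] x) * (starRingEnd ℂ) (F x)) := by
      intro h
      rw [← ih (fun x => F (T^[h] x) * (starRingEnd ℂ) (F x))]
      simp only [← Function.iterate_succ_apply', Function.iterate_succ_apply]
    simp only [h1]

theorem uniformitySeminorm_conj {X : Type*} [MeasurableSpace X] {μ : Measure X} {T : X → X}
    (k : ℕ) : ∀ F : X → ℂ,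
    uniformitySeminorm μ T k (fun x => (starRingEnd ℂ) (F x)) = uniformitySeminorm μ T k F := by
  induction k with
  | zero =>
    intro F
    simp only [uniformitySeminorm, integral_conj, Complex.conj_re]
  | succ k ih =>
    intro F
    simp only [uniformitySeminorm]
    have h1 : ∀ h : ℕ, uniformitySeminorm μ T k
        (fun x => (starRingEnd ℂ) (F (T^[h] x)) * (starRingEnd ℂ) ((starRingEnd ℂ) (F x))) =
        uniformitySeminorm μ T k (fun x => F (T^[h] x) * (starRingEnd ℂ) (F x)) := by
      intro h
      rw [← ih (fun x => F (T^[h] x) * (starRingEnd ℂ) (F x))]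
      simp only [map_mul]
    simp only [h1]

theorem uniformitySeminorm_congr_ae {X : Type*} [MeasurableSpace X] {μ : Measure X} {T : X → X}
    (hT : MeasurePreserving T μ μ) (k : ℕ) : ∀ F G : X → ℂ, F =ᵐ[μ] G →
    uniformitySeminorm μ T k F = uniformitySeminorm μ T k G := by
  induction k with
  | zero => exact fun F G h => congrArg Complex.re (integral_congr_ae h)
  | succ k ih =>
    intro F G hFG
    simp only [uniformitySeminorm]
    have h1 : ∀ h : ℕ, uniformitySeminorm μ T k
        (fun x => F (T^[h] x) * (starRingEnd ℂ) (F x)) =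
        uniformitySeminorm μ T k (fun x => G (T^[h] x) * (starRingEnd ℂ) (G x)) := by
      intro h
      refine ih _ _ ?_
      filter_upwards [hFG, (hT.iterate h).quasiMeasurePreserving.ae_eq_comp hFG] with x hx hx'
      have hx'' : F (T^[h] x) = G (T^[h] x) := hx'
      rw [hx, hx'']
    simp only [h1]

/-! ### Asymptotic upper bounds -/

/-- The real sequence `x` has upper limit at most `B`. -/
def AsympLE (x : ℕ → ℝ) (B : ℝ) : Prop := ∀ ε > 0, ∀ᶠ N in atTop, x N ≤ B + ε

namespace AsympLE

variable {x y : ℕ → ℝ} {A B : ℝ}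

theorem of_le (h : ∀ N, x N ≤ B) : AsympLE x B := fun _ hε =>
  Eventually.of_forall fun N => (h N).trans (by linarith)

theorem mono_left (h : AsympLE y B) (hxy : ∀ N, x N ≤ y N) : AsympLE x B := fun ε hε =>
  (h ε hε).mono fun N hN => (hxy N).trans hN

theorem mono_right (h : AsympLE x A) (hAB : A ≤ B) : AsympLE x B := fun ε hε =>
  (h ε hε).mono fun _ hN => hN.trans (by linarith)

theorem of_tendsto (h : Tendsto x atTop (𝓝 B)) : AsympLE x B := fun ε hε =>
  (h.eventually (gt_mem_nhds (show B < B + ε by linarith))).mono fun _ hN => hN.le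

theorem add (hx : AsympLE x A) (hy : AsympLE y B) : AsympLE (fun N => x N + y N) (A + B) := by
  intro ε hε
  filter_upwards [hx (ε / 2) (by linarith), hy (ε / 2) (by linarith)] with N h1 h2
  linarith

theorem sum {ι : Type*} (s : Finset ι) {x : ι → ℕ → ℝ} {B : ι → ℝ}
    (h : ∀ i ∈ s, AsympLE (x i) (B i)) :
    AsympLE (fun N => ∑ i ∈ s, x i N) (∑ i ∈ s, B i) := by
  classical
  induction s using Finset.induction_on with
  | empty => exact of_le fun N => by simp
  | insert i s hi ih =>
    simp only [Finset.sum_insert hi]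
    exact (h i (Finset.mem_insert_self _ _)).add
      (ih fun k hk => h k (Finset.mem_insert_of_mem hk))

theorem const_mul {c : ℝ} (hc : 0 < c) (h : AsympLE x B) : AsympLE (fun N => c * x N) (c * B) := by
  intro ε hε
  filter_upwards [h (ε / c) (by positivity)] with N hN
  calc c * x N ≤ c * (B + ε / c) := mul_le_mul_of_nonneg_left hN hc.le
    _ = c * B + ε := by field_simp

theorem sqrt (h : AsympLE (fun N => x N ^ 2) B) : AsympLE x (Real.sqrt B) := by
  intro ε hε
  have h1 : 0 ≤ Real.sqrt B := Real.sqrt_nonneg B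
  have h2 : B ≤ Real.sqrt B ^ 2 := by
    rcases le_total 0 B with hB | hB
    · rw [Real.sq_sqrt hB]
    · exact hB.trans (sq_nonneg _)
  filter_upwards [h (ε ^ 2) (by positivity)] with N hN
  refine le_of_sq_le_sq ?_ (by linarith)
  nlinarith

/-- Serves the double limit in van der Corput's method: `N → ∞` for each fixed `H`, and only then `H
→ ∞`. -/
theorem of_tendsto_bound {D : ℕ → ℝ} (hD : Tendsto D atTop (𝓝 B))
    (h : ∀ᶠ H in atTop, AsympLE x (D H)) : AsympLE x B := by
  intro ε hε
  obtain ⟨H, h1, h2⟩ := ((of_tendsto hD (ε / 2) (by linarith)).and h).exists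
  filter_upwards [h2 (ε / 2) (by linarith)] with N hN
  linarith

theorem limsup_le (h : AsympLE x B) :
    limsup (fun N => ENNReal.ofReal (x N)) atTop ≤ ENNReal.ofReal B := by
  refine ENNReal.le_of_forall_pos_le_add fun ε hε _ => ?_
  refine Filter.limsup_le_of_le (by isBoundedDefault) ?_
  filter_upwards [h ε (by exact_mod_cast hε)] with N hN
  refine (ENNReal.ofReal_le_ofReal hN).trans (ENNReal.ofReal_add_le.trans_eq ?_)
  rw [ENNReal.ofReal_coe_nnreal]

end AsympLE

/-! ### Van der Corput's inequality along Følner sequences -/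

section VanDerCorput

/-- The average of a sequence of vectors over a finite set of indices. -/
noncomputable def finsetMean {E : Type*} [AddCommGroup E] [Module ℂ E] (A : Finset ℕ)
    (u : ℕ → E) : E := ((A.card : ℂ)⁻¹) • ∑ n ∈ A, u n

variable {E : Type*} [SeminormedAddCommGroup E] {Φ : ℕ → Finset ℕ}

theorem norm_sum_shift_sub_le {u : ℕ → E} {M : ℝ} (hu : ∀ n, ‖u n‖ ≤ M) (A : Finset ℕ) (k : ℕ) :
    ‖∑ n ∈ A, u (n + k) - ∑ n ∈ A, u n‖ ≤
      M * (symmDiff A (A.image fun n => n + k)).card := by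
  classical
  rw [← Finset.sum_image (f := u) (g := fun n => n + k) (fun a _ b _ h => by simpa using h),
    ← Finset.sum_sdiff_sub_sum_sdiff]
  set B := A.image fun n => n + k
  have h1 : (symmDiff A B).card = (B \ A).card + (A \ B).card := by
    rw [symmDiff_comm]
    exact Finset.card_union_of_disjoint disjoint_sdiff_sdiff
  rw [h1]
  have h2 : ∀ D : Finset ℕ, ‖∑ n ∈ D, u n‖ ≤ M * D.card := fun D =>
    (norm_sum_le_of_le D fun n _ => hu n).trans_eq (by simp [mul_comm])
  push_cast
  rw [mul_add]
  exact (norm_sub_le _ _).trans (add_le_add (h2 _) (h2 _))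

variable [InnerProductSpace ℂ E]

theorem tendsto_finsetMean_shift (hΦ : IsFolnerSeq Φ) {u : ℕ → E} {M : ℝ} (hu : ∀ n, ‖u n‖ ≤ M)
    (k : ℕ) :
    Tendsto (fun N => ‖finsetMean (Φ N) (fun n => u (n + k)) - finsetMean (Φ N) u‖) atTop
      (𝓝 0) := by
  have h1 := (hΦ.2 k).const_mul M
  rw [mul_zero] at h1
  refine squeeze_zero (fun N => norm_nonneg _) (fun N => ?_) h1
  rw [finsetMean, finsetMean, ← smul_sub, norm_smul, norm_inv, Complex.norm_natCast, mul_div_assoc',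
    div_eq_inv_mul]
  exact mul_le_mul_of_nonneg_left (norm_sum_shift_sub_le hu _ _) (by positivity)

theorem norm_finsetMean_sq_le (A : Finset ℕ) (v : ℕ → E) :
    ‖finsetMean A v‖ ^ 2 ≤ (finsetMean A fun n => inner ℂ (v n) (v n)).re := by
  have h1 : (finsetMean A fun n => inner ℂ (v n) (v n)).re =
      (A.card : ℝ)⁻¹ * ∑ n ∈ A, ‖v n‖ ^ 2 := by
    rw [finsetMean, ← Complex.ofReal_natCast, ← Complex.ofReal_inv, smul_eq_mul,
      Complex.re_ofReal_mul, Complex.re_sum]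
    congr 1
    exact Finset.sum_congr rfl fun n _ => inner_self_eq_norm_sq (𝕜 := ℂ) (v n)
  rw [h1, finsetMean, norm_smul, norm_inv, Complex.norm_natCast, mul_pow]
  rcases A.eq_empty_or_nonempty with rfl | hA
  · simp
  have hc : (0 : ℝ) < A.card := by exact_mod_cast hA.card_pos
  have h2 : ‖∑ n ∈ A, v n‖ ^ 2 ≤ A.card * ∑ n ∈ A, ‖v n‖ ^ 2 :=
    (pow_le_pow_left₀ (norm_nonneg _) (norm_sum_le _ _) 2).trans sq_sum_le_card_mul_sum_sq
  calc ((A.card : ℝ)⁻¹) ^ 2 * ‖∑ n ∈ A, v n‖ ^ 2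
      ≤ ((A.card : ℝ)⁻¹) ^ 2 * (A.card * ∑ n ∈ A, ‖v n‖ ^ 2) :=
        mul_le_mul_of_nonneg_left h2 (by positivity)
    _ = (A.card : ℝ)⁻¹ * ∑ n ∈ A, ‖v n‖ ^ 2 := by field_simp

theorem sum_sum_dist_le {a : ℕ → ℝ} (ha : ∀ d, 0 ≤ a d) (H : ℕ) :
    ∑ h ∈ Finset.range H, ∑ k ∈ Finset.range H, a (Nat.dist h k) ≤
      H * (2 * ∑ d ∈ Finset.range H, a d) := by
  have h1 : ∀ h ∈ Finset.range H, ∑ k ∈ Finset.range H, a (Nat.dist h k) ≤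
      2 * ∑ d ∈ Finset.range H, a d := by
    intro h hh
    rw [Finset.mem_range] at hh
    have h2 : ∀ s : Finset ℕ, s ⊆ Finset.range H → Set.InjOn (Nat.dist h) s →
        ∑ k ∈ s, a (Nat.dist h k) ≤ ∑ d ∈ Finset.range H, a d := by
      intro s hs hinj
      rw [← Finset.sum_image hinj]
      refine Finset.sum_le_sum_of_subset_of_nonneg ?_ fun d _ _ => ha d
      intro d hd
      obtain ⟨k, hk, rfl⟩ := Finset.mem_image.1 hd
      have := Finset.mem_range.1 (hs hk)
      rw [Finset.mem_range, Nat.dist]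
      omega
    rw [← Finset.sum_filter_add_sum_filter_not _ (fun k => k ≤ h), two_mul]
    -- For fixed `h` the distance is injective on each of `k ≤ h` and `k > h`, so each lag occurs at
    -- most twice; hence the factor 2.
    refine add_le_add (h2 _ (Finset.filter_subset _ _) ?_) (h2 _ (Finset.filter_subset _ _) ?_)
    · intro k hk l hl hkl
      simp only [Finset.coe_filter, Set.mem_ofPred_eq, Nat.dist] at hk hl hkl
      omega
    · intro k hk l hl hkl
      simp only [Finset.coe_filter, Set.mem_ofPred_eq, Nat.dist] at hk hl hkl
      omega
  exact (Finset.sum_le_sum h1).trans_eq (by simp)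

/-- **Van der Corput's inequality** along a Følner sequence. -/
theorem vanDerCorput (hΦ : IsFolnerSeq Φ) {u : ℕ → E} (hu : ∀ n, ‖u n‖ ≤ 1) {a : ℕ → ℝ}
    (ha0 : ∀ d, 0 ≤ a d)
    (ha : ∀ d, AsympLE (fun N => ‖finsetMean (Φ N) fun n => inner ℂ (u (n + d)) (u n)‖) (a d))
    {H : ℕ} (hH : 0 < H) :
    AsympLE (fun N => ‖finsetMean (Φ N) u‖)
      (Real.sqrt (2 / H * ∑ d ∈ Finset.range H, a d)) := by
  have hH' : (0 : ℝ) < H := by exact_mod_cast hH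
  have hin : ∀ m n, ‖inner ℂ (u m) (u n)‖ ≤ 1 := fun m n =>
    (norm_inner_le_norm _ _).trans (mul_le_one₀ (hu m) (norm_nonneg _) (hu n))
  -- Shifting `n` by `min h k`, free in the limit by the Følner property, leaves only the lag `|h -
  -- k|`. If `h < k`, conjugation first exchanges the two entries.
  have hpair : ∀ h k, AsympLE
      (fun N => ‖finsetMean (Φ N) fun n => inner ℂ (u (n + h)) (u (n + k))‖)
      (a (Nat.dist h k)) := by
    have hle : ∀ d k, AsympLE
        (fun N => ‖finsetMean (Φ N) fun n => inner ℂ (u (n + k + d)) (u (n + k))‖) (a d) := by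
      intro d k
      have h1 := (ha d).add (AsympLE.of_tendsto (tendsto_finsetMean_shift hΦ
        (u := fun n => inner ℂ (u (n + d)) (u n)) (fun n => hin _ _) k))
      rw [add_zero] at h1
      refine h1.mono_left fun N => ?_
      have h2 := norm_add_le (finsetMean (Φ N) fun n => inner ℂ (u (n + d)) (u n))
        ((finsetMean (Φ N) fun n => inner ℂ (u (n + k + d)) (u (n + k))) -
          finsetMean (Φ N) fun n => inner ℂ (u (n + d)) (u n))
      rwa [add_sub_cancel] at h2
    intro h k
    rcases le_total k h with hkh | hkh
    · have h1 := hle (h - k) k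
      have h2 : Nat.dist h k = h - k := Nat.dist_eq_sub_of_le_right hkh
      have h3 : ∀ n, n + k + (h - k) = n + h := fun n => by omega
      simpa only [h2, h3] using h1
    · have h1 := hle (k - h) h
      have h2 : Nat.dist h k = k - h := Nat.dist_eq_sub_of_le hkh
      have h3 : ∀ n, n + h + (k - h) = n + k := fun n => by omega
      simp only [h3] at h1
      rw [h2]
      refine h1.mono_left fun N => le_of_eq ?_
      rw [← RCLike.norm_conj]
      simp only [finsetMean, smul_eq_mul, map_mul, map_inv₀, map_natCast, map_sum,
        inner_conj_symm]
  have hv : AsympLE (fun N => ‖finsetMean (Φ N) fun n => ∑ h ∈ Finset.range H, u (n + h)‖ ^ 2)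
      (H * (2 * ∑ d ∈ Finset.range H, a d)) := by
    refine ((AsympLE.sum (Finset.range H) fun h _ =>
      AsympLE.sum (Finset.range H) fun k _ => hpair h k).mono_left fun N => ?_).mono_right
        (sum_sum_dist_le ha0 H)
    refine (norm_finsetMean_sq_le _ _).trans ((Complex.re_le_norm _).trans ?_)
    have h1 : (finsetMean (Φ N) fun n => inner ℂ (∑ h ∈ Finset.range H, u (n + h))
        (∑ h ∈ Finset.range H, u (n + h))) = ∑ h ∈ Finset.range H, ∑ k ∈ Finset.range H,
          finsetMean (Φ N) fun n => inner ℂ (u (n + h)) (u (n + k)) := by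
      simp only [finsetMean, sum_inner, inner_sum, ← Finset.smul_sum]
      congr 1
      rw [Finset.sum_comm]
      exact (Finset.sum_congr rfl fun k _ => Finset.sum_comm).trans Finset.sum_comm
    rw [h1]
    exact (norm_sum_le _ _).trans (Finset.sum_le_sum fun h _ => norm_sum_le _ _)
  have h1 := hv.sqrt.add (AsympLE.sum (Finset.range H) fun h _ =>
    AsympLE.of_tendsto (tendsto_finsetMean_shift hΦ hu h))
  rw [Finset.sum_const_zero, add_zero] at h1
  have h2 : AsympLE (fun N => H * ‖finsetMean (Φ N) u‖)
      (Real.sqrt (H * (2 * ∑ d ∈ Finset.range H, a d))) := by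
    refine h1.mono_left fun N => ?_
    have h3 : (finsetMean (Φ N) fun n => ∑ h ∈ Finset.range H, u (n + h)) =
        ∑ h ∈ Finset.range H, finsetMean (Φ N) fun n => u (n + h) := by
      simp only [finsetMean, ← Finset.smul_sum]
      rw [Finset.sum_comm]
    -- `H` times the mean is the mean of the window sums, up to `H` shift errors that vanish as `N →
    -- ∞`.
    have h4 : (H : ℂ) • finsetMean (Φ N) u =
        (finsetMean (Φ N) fun n => ∑ h ∈ Finset.range H, u (n + h)) -
          ∑ h ∈ Finset.range H, ((finsetMean (Φ N) fun n => u (n + h)) - finsetMean (Φ N) u) := by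
      rw [h3, Finset.sum_sub_distrib, sub_sub_cancel, Finset.sum_const, Finset.card_range,
        Nat.cast_smul_eq_nsmul]
    have h5 : (H : ℝ) * ‖finsetMean (Φ N) u‖ = ‖(H : ℂ) • finsetMean (Φ N) u‖ := by
      rw [norm_smul, Complex.norm_natCast]
    rw [h5, h4]
    exact (norm_sub_le _ _).trans (add_le_add le_rfl (norm_sum_le _ _))
  have h3 := h2.const_mul (inv_pos.2 hH')
  have h4 : (H : ℝ)⁻¹ * Real.sqrt (H * (2 * ∑ d ∈ Finset.range H, a d)) =
      Real.sqrt (2 / H * ∑ d ∈ Finset.range H, a d) := by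
    have : 2 / (H : ℝ) * ∑ d ∈ Finset.range H, a d =
        ((H : ℝ)⁻¹) ^ 2 * (H * (2 * ∑ d ∈ Finset.range H, a d)) := by
      field_simp
    rw [this, Real.sqrt_mul (sq_nonneg _), Real.sqrt_sq (by positivity)]
  rw [h4] at h3
  exact h3.mono_left fun N => by rw [inv_mul_cancel_left₀ hH'.ne']

end VanDerCorput

/-! ### Integer powers of `T`, functions bounded by one, and the `L²` norm -/

/-- The measurable functions bounded by one in absolute value. -/
def unitFunctions (X : Type*) [MeasurableSpace X] : Set (X → ℂ) :=
  {F | Measurable F ∧ ∀ x, ‖F x‖ ≤ 1}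

/-- The power `T^m` of an invertible map, for an integer `m`. -/
def intIterate {X : Type*} [MeasurableSpace X] (T : X ≃ᵐ X) (m : ℤ) : X → X :=
  ((T.toEquiv : Equiv.Perm X) ^ m : Equiv.Perm X)

section IntIterate

variable {X : Type*} [MeasurableSpace X] {μ : Measure X} {T : X ≃ᵐ X}

theorem intIterate_add (m n : ℤ) (x : X) :
    intIterate T (m + n) x = intIterate T m (intIterate T n x) := by
  simp [intIterate, zpow_add]

theorem intIterate_natCast (n : ℕ) (x : X) : intIterate T n x = T^[n] x := by
  rw [intIterate, zpow_natCast, ← Equiv.Perm.iterate_eq_pow]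
  rfl

theorem intIterate_neg_natCast (n : ℕ) (x : X) : intIterate T (-n) x = T.symm^[n] x := by
  rw [intIterate, zpow_neg, zpow_natCast, ← inv_pow, ← Equiv.Perm.iterate_eq_pow]
  rfl

theorem intIterate_zero (x : X) : intIterate T 0 x = x := rfl

theorem measurePreserving_intIterate (hT : MeasurePreserving T μ μ) (m : ℤ) :
    MeasurePreserving (intIterate T m) μ μ := by
  obtain ⟨n, rfl | rfl⟩ := m.eq_nat_or_neg
  · have : intIterate T n = T^[n] := funext (intIterate_natCast n)
    rw [this]
    exact hT.iterate n
  · have : intIterate T (-n) = T.symm^[n] := funext (intIterate_neg_natCast n)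
    rw [this]
    exact (hT.symm T).iterate n

theorem integral_intIterate (hT : MeasurePreserving T μ μ) (m : ℤ) {F : X → ℂ}
    (hF : Measurable F) : ∫ x, F (intIterate T m x) ∂μ = ∫ x, F x ∂μ := by
  have h := measurePreserving_intIterate hT m
  conv_rhs => rw [← h.map_eq]
  exact (integral_map h.measurable.aemeasurable
    hF.aestronglyMeasurable).symm

end IntIterate

section UnitFunctions

variable {X : Type*} [MeasurableSpace X] {μ : Measure X} {T : X ≃ᵐ X} {F G : X → ℂ}

theorem unitFunctions.mem_boundedMeasurable (hF : F ∈ unitFunctions X) :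
    F ∈ boundedMeasurable X := ⟨hF.1, 1, hF.2⟩

theorem unitFunctions.mul (hF : F ∈ unitFunctions X) (hG : G ∈ unitFunctions X) :
    (fun x => F x * G x) ∈ unitFunctions X :=
  ⟨hF.1.mul hG.1, fun x => by
    rw [norm_mul]
    exact mul_le_one₀ (hF.2 x) (norm_nonneg _) (hG.2 x)⟩

theorem unitFunctions.conj (hF : F ∈ unitFunctions X) :
    (fun x => (starRingEnd ℂ) (F x)) ∈ unitFunctions X :=
  ⟨Complex.continuous_conj.measurable.comp hF.1, fun x => by simpa using hF.2 x⟩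

theorem unitFunctions.comp (hF : F ∈ unitFunctions X) {R : X → X} (hR : Measurable R) :
    (fun x => F (R x)) ∈ unitFunctions X :=
  ⟨hF.1.comp hR, fun _ => hF.2 _⟩

theorem unitFunctions.prod {ι : Type*} (s : Finset ι) {f : ι → X → ℂ}
    (hf : ∀ i, f i ∈ unitFunctions X) : (fun x => ∏ i ∈ s, f i x) ∈ unitFunctions X :=
  ⟨Finset.measurable_prod s fun i _ => (hf i).1, fun x => by
    rw [norm_prod]
    exact Finset.prod_le_one (fun _ _ => norm_nonneg _) fun i _ => (hf i).2 x⟩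

theorem unitFunctions.const_mul {b : ℂ} (hb : ‖b‖ ≤ 1) (hF : F ∈ unitFunctions X) :
    (fun x => b * F x) ∈ unitFunctions X :=
  unitFunctions.mul ⟨measurable_const, fun _ => hb⟩ hF

theorem unitFunctions.mean {u : ℕ → X → ℂ} (hu : ∀ n, u n ∈ unitFunctions X) (A : Finset ℕ) :
    (fun x => finsetMean A fun n => u n x) ∈ unitFunctions X := by
  refine ⟨(Finset.measurable_fun_sum A fun n _ => (hu n).1).const_mul ((A.card : ℂ)⁻¹),
    fun x => ?_⟩
  simp only [finsetMean]
  rw [norm_smul, norm_inv, Complex.norm_natCast]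
  refine (mul_le_mul_of_nonneg_left (norm_sum_le_of_le A fun n _ => (hu n).2 x)
    (by positivity)).trans ?_
  simp only [Finset.sum_const, nsmul_eq_mul, mul_one]
  exact inv_mul_le_one

/-- The `L²` seminorm, as a real number. -/
noncomputable def l2Norm (μ : Measure X) (F : X → ℂ) : ℝ := Real.sqrt (∫ x, ‖F x‖ ^ 2 ∂μ)

theorem ofReal_l2Norm [IsFiniteMeasure μ] (hF : F ∈ unitFunctions X) :
    eLpNorm F 2 μ = ENNReal.ofReal (l2Norm μ F) := by
  have hm : MemLp F 2 μ := MemLp.of_bound hF.1.aestronglyMeasurable 1 (Eventually.of_forall hF.2)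
  rw [hm.eLpNorm_eq_integral_rpow_norm (by norm_num) (by norm_num), l2Norm, Real.sqrt_eq_rpow]
  norm_num

/-- The average of the functions `b_n T^{c_1 n} f_1 ⋯ T^{c_s n} f_s`, with integers `c_i`. -/
noncomputable def intErgodicAverage (T : X ≃ᵐ X) {s : ℕ} (c : Fin s → ℤ) (b : ℕ → ℂ)
    (f : Fin s → X → ℂ) (A : Finset ℕ) : X → ℂ :=
  fun x => finsetMean A fun n => b n * ∏ i, f i (intIterate T (c i * n) x)

theorem unitFunctions.ergodicTerm (hT : MeasurePreserving T μ μ) {s : ℕ} (c : Fin s → ℤ)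
    {b : ℂ} (hb : ‖b‖ ≤ 1) {f : Fin s → X → ℂ} (hf : ∀ i, f i ∈ unitFunctions X) (n : ℕ) :
    (fun x => b * ∏ i, f i (intIterate T (c i * n) x)) ∈ unitFunctions X :=
  unitFunctions.const_mul hb (unitFunctions.prod _ fun i =>
    unitFunctions.comp (hf i) (measurePreserving_intIterate hT _).measurable)

theorem unitFunctions.ergodicAverage (hT : MeasurePreserving T μ μ) {s : ℕ} (c : Fin s → ℤ)
    {b : ℕ → ℂ} (hb : ∀ n, ‖b n‖ ≤ 1) {f : Fin s → X → ℂ} (hf : ∀ i, f i ∈ unitFunctions X)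
    (A : Finset ℕ) : intErgodicAverage T c b f A ∈ unitFunctions X :=
  unitFunctions.mean (fun n => unitFunctions.ergodicTerm hT c (hb n) hf n) A

variable [IsProbabilityMeasure μ]

/-- The van der Corput inequality in `L²(μ)`. -/
theorem vanDerCorput_l2Norm (hT : MeasurePreserving T μ μ) {Φ : ℕ → Finset ℕ}
    (hΦ : IsFolnerSeq Φ) {u : ℕ → X → ℂ} (hu : ∀ n, u n ∈ unitFunctions X) {a : ℕ → ℝ}
    (ha0 : ∀ d, 0 ≤ a d)
    (ha : ∀ d, AsympLE (fun N => ‖finsetMean (Φ N) fun n =>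
      ∫ x, (starRingEnd ℂ) (u (n + d) x) * u n x ∂μ‖) (a d)) {H : ℕ} (hH : 0 < H) :
    AsympLE (fun N => l2Norm μ (fun x => finsetMean (Φ N) fun n => u n x))
      (Real.sqrt (2 / H * ∑ d ∈ Finset.range H, a d)) := by
  have hφ := isInvariantState_integral hT
  let c : PreInnerProductSpace.Core ℂ (boundedMeasurable X) := hφ.core
  let : SeminormedAddCommGroup (boundedMeasurable X) :=
    InnerProductSpace.Core.toSeminormedAddCommGroup (𝕜 := ℂ)
  let : InnerProductSpace ℂ (boundedMeasurable X) := InnerProductSpace.ofCore c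
  have hin : ∀ A B : boundedMeasurable X,
    inner ℂ A B = ∫ x, (starRingEnd ℂ) (A.1 x) * B.1 x ∂μ := fun _ _ => rfl
  have hnorm : ∀ A : boundedMeasurable X, ‖A‖ = l2Norm μ A.1 := by
    intro A
    have h1 : ‖A‖ ^ 2 = ∫ x, ‖A.1 x‖ ^ 2 ∂μ := by
      rw [← inner_self_eq_norm_sq (𝕜 := ℂ), hin]
      have : ∀ x, (starRingEnd ℂ) (A.1 x) * A.1 x = ((‖A.1 x‖ ^ 2 : ℝ) : ℂ) := fun x => by
        rw [mul_comm, Complex.mul_conj, Complex.normSq_eq_norm_sq]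
      simp only [this]
      rw [integral_complex_ofReal]
      exact Complex.ofReal_re _
    rw [l2Norm, ← h1, Real.sqrt_sq (norm_nonneg _)]
  let v : ℕ → boundedMeasurable X := fun n => ⟨u n, unitFunctions.mem_boundedMeasurable (hu n)⟩
  have hv : ∀ n, ‖v n‖ ≤ 1 := by
    intro n
    rw [hnorm, l2Norm]
    refine (Real.sqrt_le_sqrt ?_).trans_eq Real.sqrt_one
    have h1 : ∀ x, ‖(v n).1 x‖ ^ 2 ≤ 1 := fun x => pow_le_one₀ (norm_nonneg _) ((hu n).2 x)
    refine (integral_mono_of_nonneg (Eventually.of_forall fun x => sq_nonneg _)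
      (integrable_const (1 : ℝ)) (Eventually.of_forall h1)).trans ?_
    simp
  refine (vanDerCorput hΦ hv ha0 ha hH).mono_left fun N => le_of_eq ?_
  rw [hnorm]
  congr 1
  ext x
  simp [finsetMean, v]

theorem norm_integral_mul_le_l2Norm (hF : F ∈ unitFunctions X) (hG : G ∈ unitFunctions X) :
    ‖∫ x, F x * G x ∂μ‖ ≤ l2Norm μ G := by
  have h0 : ‖∫ x, F x * G x ∂μ‖ ≤ ∫ x, ‖G x‖ ∂μ := by
    refine norm_integral_le_of_norm_le
      (integrable_of_boundedMeasurable (unitFunctions.mem_boundedMeasurable hG)).norm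
      (Eventually.of_forall fun x => ?_)
    rw [norm_mul]
    exact mul_le_of_le_one_left (norm_nonneg _) (hF.2 x)
  have h1 : MemLp (fun x => ‖G x‖) 2 μ :=
    MemLp.of_bound hG.1.norm.aestronglyMeasurable 1 (Eventually.of_forall fun x => by
      simpa using hG.2 x)
  refine h0.trans (Real.le_sqrt_of_sq_le ?_)
  -- Nonnegative variance of `‖G‖` is the inequality `(∫ ‖G‖)² ≤ ∫ ‖G‖²`.
  have h2 := ProbabilityTheory.variance_nonneg (fun x => ‖G x‖) μ
  rw [ProbabilityTheory.variance_eq_sub h1] at h2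
  simp only [Pi.pow_apply] at h2
  linarith

end UnitFunctions

/-! ### Averaging seminorms of derivatives -/

section Step

variable {X : Type*} [MeasurableSpace X] {μ : Measure X} {T : X ≃ᵐ X}

/-- Conjugation handles `c ≥ 0`. For `c = -q`, composing with `T^{qd}` moves the negative power onto
the other factor. Neither operation changes the seminorm. -/
theorem uniformitySeminorm_intIterate_deriv (hT : MeasurePreserving T μ μ) (k : ℕ) (F : X → ℂ)
    (c : ℤ) (d : ℕ) :
    uniformitySeminorm μ T k (fun x => (starRingEnd ℂ) (F (intIterate T (c * d) x)) * F x) =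
      uniformitySeminorm μ T k (fun x => F (T^[c.natAbs * d] x) * (starRingEnd ℂ) (F x)) := by
  have hcomp : ∀ (n : ℕ) (G : X → ℂ),
      uniformitySeminorm μ T k (fun x => G (T^[n] x)) = uniformitySeminorm μ T k G := by
    intro n
    induction n with
    | zero => exact fun G => rfl
    | succ n ih =>
      intro G
      rw [← ih G, ← uniformitySeminorm_comp hT k fun x => G (T^[n] x)]
      rfl
  obtain ⟨q, rfl | rfl⟩ := c.eq_nat_or_neg
  · rw [← uniformitySeminorm_conj]
    simp only [← Nat.cast_mul, intIterate_natCast, Int.natAbs_natCast, map_mul, Complex.conj_conj]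
  · rw [← hcomp (q * d)]
    have h1 : ∀ x, intIterate T (-(q : ℤ) * d) (T^[q * d] x) = x := by
      intro x
      rw [← intIterate_natCast, ← intIterate_add]
      simp [intIterate_zero]
    simp only [h1, Int.natAbs_neg, Int.natAbs_natCast]
    simp only [mul_comm]

/-- The power mean inequality raises the terms to the power `p + 1`; positivity then allows adding
the indices below `q H` that are not multiples of `q`. Renormalising costs the factor `q`. -/
theorem average_dilate_le {w : ℕ → ℝ} (hw : ∀ h, 0 ≤ w h) (p : ℕ) {q H : ℕ} (hq : 0 < q)
    (hH : 0 < H) :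
    (1 / (H : ℝ)) * ∑ d ∈ Finset.range H, w (q * d) ≤
      (q * ((1 / ((q * H : ℕ) : ℝ)) * ∑ h ∈ Finset.range (q * H), w h ^ (p + 1))) ^
        ((1 : ℝ) / (p + 1 : ℕ)) := by
  have hH' : (0 : ℝ) < H := by exact_mod_cast hH
  have hq' : (0 : ℝ) < q := by exact_mod_cast hq
  have h0 : 0 ≤ (1 / (H : ℝ)) * ∑ d ∈ Finset.range H, w (q * d) :=
    mul_nonneg (by positivity) (Finset.sum_nonneg fun d _ => hw _)
  have h2 : ∑ d ∈ Finset.range H, w (q * d) ^ (p + 1) ≤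
      ∑ h ∈ Finset.range (q * H), w h ^ (p + 1) := by
    rw [← Finset.sum_image (f := fun h => w h ^ (p + 1)) (g := fun d => q * d)
      (fun a _ b _ h => Nat.eq_of_mul_eq_mul_left hq h)]
    refine Finset.sum_le_sum_of_subset_of_nonneg ?_ fun h _ _ => pow_nonneg (hw h) _
    intro h hh
    obtain ⟨d, hd, rfl⟩ := Finset.mem_image.1 hh
    exact Finset.mem_range.2 (Nat.mul_lt_mul_of_pos_left (Finset.mem_range.1 hd) hq)
  have h3 : ((1 / (H : ℝ)) * ∑ d ∈ Finset.range H, w (q * d)) ^ (p + 1) ≤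
      q * ((1 / ((q * H : ℕ) : ℝ)) * ∑ h ∈ Finset.range (q * H), w h ^ (p + 1)) := by
    have h4 := pow_sum_div_card_le_sum_pow (s := Finset.range H) (f := fun d => w (q * d))
      (fun d _ => hw _) p
    rw [Finset.card_range] at h4
    have h5 : (q : ℝ) * ((1 / ((q * H : ℕ) : ℝ)) * ∑ h ∈ Finset.range (q * H), w h ^ (p + 1)) =
        (1 / (H : ℝ)) * ∑ h ∈ Finset.range (q * H), w h ^ (p + 1) := by
      push_cast
      field_simp
    rw [h5]
    calc ((1 / (H : ℝ)) * ∑ d ∈ Finset.range H, w (q * d)) ^ (p + 1)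
        = (1 / (H : ℝ)) * ((∑ d ∈ Finset.range H, w (q * d)) ^ (p + 1) / (H : ℝ) ^ p) := by
          rw [mul_pow, div_pow, one_pow, pow_succ (H : ℝ)]
          field_simp
      _ ≤ _ := mul_le_mul_of_nonneg_left (h4.trans h2) (by positivity)
  have h4 := Real.rpow_le_rpow (pow_nonneg h0 _) h3 (show 0 ≤ (1 : ℝ) / (p + 1 : ℕ) by positivity)
  rwa [one_div ((p + 1 : ℕ) : ℝ), Real.pow_rpow_inv_natCast h0 (Nat.succ_ne_zero p),
    ← one_div ((p + 1 : ℕ) : ℝ)] at h4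

variable [IsProbabilityMeasure μ]

/-- Averaging the seminorms of the multiplicative derivatives along multiples of `c`. -/
theorem AsympLE.uniformitySeminorm_succ (hT : MeasurePreserving T μ μ) (k : ℕ) {F : X → ℂ}
    (hF : F ∈ boundedMeasurable X) {c : ℤ} (hc : c ≠ 0) {C : ℝ} (hC : 0 ≤ C) {x : ℕ → ℝ}
    (hx : ∀ H : ℕ, 0 < H → AsympLE x (Real.sqrt (2 / H * ∑ d ∈ Finset.range H,
      C * uniformitySeminorm μ T (k + 1)
        (fun y => (starRingEnd ℂ) (F (intIterate T (c * d) y)) * F y)))) :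
    AsympLE x (Real.sqrt (2 * C * c.natAbs) * uniformitySeminorm μ T (k + 2) F) := by
  set q := c.natAbs with hq
  have hq0 : 0 < q := Int.natAbs_pos.2 hc
  set w : ℕ → ℝ := fun h => uniformitySeminorm μ T (k + 1)
    (fun y => F (T^[h] y) * (starRingEnd ℂ) (F y)) with hwdef
  have hw : ∀ h, 0 ≤ w h := fun h =>
    uniformitySeminorm_nonneg hT k (boundedMeasurable.shift_mul_conj hF T.measurable h)
  -- With `p + 1 = 2^(k+1)`, the limit defining `V` reads `V^(2^(k+2)) = (V²)^(p+1)`. The root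
  -- returns `V²`, and the square root from van der Corput returns `V`.
  obtain ⟨p, hp⟩ : ∃ p, 2 ^ (k + 1) = p + 1 :=
    Nat.exists_eq_succ_of_ne_zero (pow_ne_zero _ two_ne_zero)
  set V := uniformitySeminorm μ T (k + 2) F with hV
  have hV0 : 0 ≤ V := uniformitySeminorm_nonneg hT (k + 1) hF
  have hlim : Tendsto (fun H : ℕ => (1 / (H : ℝ)) * ∑ h ∈ Finset.range H, w h ^ (p + 1)) atTop
      (𝓝 ((V ^ 2) ^ (p + 1))) := by
    have h1 := tendsto_uniformitySeminorm hT (k + 1) hF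
    rw [pow_succ 2 (k + 1), mul_comm _ 2, pow_mul, hp] at h1
    exact h1
  have hlim2 : Tendsto (fun H : ℕ => Real.sqrt (2 * C * (q * ((1 / ((q * H : ℕ) : ℝ)) *
      ∑ h ∈ Finset.range (q * H), w h ^ (p + 1))) ^ ((1 : ℝ) / (p + 1 : ℕ)))) atTop
      (𝓝 (Real.sqrt (2 * C * (q * (V ^ 2) ^ (p + 1)) ^ ((1 : ℝ) / (p + 1 : ℕ))))) := by
    have h1 := hlim.comp (tendsto_id.const_mul_atTop' hq0)
    exact (((h1.const_mul (q : ℝ)).rpow_const (Or.inr (by positivity))).const_mul (2 * C)).sqrt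
  refine (AsympLE.of_tendsto_bound hlim2 ?_).mono_right ?_
  · filter_upwards [eventually_gt_atTop 0] with H hH
    refine (hx H hH).mono_right (Real.sqrt_le_sqrt ?_)
    simp only [uniformitySeminorm_intIterate_deriv hT (k + 1) F c]
    rw [← Finset.mul_sum]
    refine le_trans (le_of_eq ?_)
      (mul_le_mul_of_nonneg_left (average_dilate_le hw p hq0 hH) (by positivity))
    ring
  · have hq1 : (1 : ℝ) ≤ q := by exact_mod_cast hq0
    have h1 : ((q : ℝ) * (V ^ 2) ^ (p + 1)) ^ ((1 : ℝ) / (p + 1 : ℕ)) ≤ q * V ^ 2 := by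
      rw [Real.mul_rpow (by positivity) (by positivity), one_div,
        Real.pow_rpow_inv_natCast (sq_nonneg V) (Nat.succ_ne_zero p)]
      refine mul_le_mul_of_nonneg_right ?_ (sq_nonneg V)
      refine (Real.rpow_le_rpow_of_exponent_le hq1 (y := ((p + 1 : ℕ) : ℝ)⁻¹) (z := 1) ?_).trans_eq
        (Real.rpow_one _)
      exact Nat.cast_inv_le_one _
    calc Real.sqrt (2 * C * ((q : ℝ) * (V ^ 2) ^ (p + 1)) ^ ((1 : ℝ) / (p + 1 : ℕ)))
        ≤ Real.sqrt (2 * C * (q * V ^ 2)) :=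
          Real.sqrt_le_sqrt (mul_le_mul_of_nonneg_left h1 (by positivity))
      _ = Real.sqrt (2 * C * q) * V := by
          rw [← mul_assoc, Real.sqrt_mul (by positivity), Real.sqrt_sq hV0]

end Step

/-! ### Induction between correlations and averages -/

/-- The correlations of the functions `f_i` along `c` are controlled by a seminorm of `f_j`. -/
def CorrelationBound (m : ℕ) (c : Fin (m + 1) → ℤ) (j : Fin (m + 1)) (C : ℝ) : Prop :=
  ∀ (X : Type u) [MeasurableSpace X] (μ : Measure X) [IsProbabilityMeasure μ] (T : X ≃ᵐ X),
    MeasurePreserving T μ μ → ∀ b : ℕ → ℂ, (∀ n, ‖b n‖ ≤ 1) →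
    ∀ f : Fin (m + 1) → X → ℂ, (∀ i, f i ∈ unitFunctions X) →
    ∀ Φ : ℕ → Finset ℕ, IsFolnerSeq Φ →
      AsympLE (fun N => ‖finsetMean (Φ N) fun n =>
        b n * ∫ x, ∏ i, f i (intIterate T (c i * n) x) ∂μ‖)
        (C * uniformitySeminorm μ T (m + 1) (f j))

/-- The averages of the functions `f_i` along `c` are controlled by a seminorm of `f_j`. -/
def AverageBound (m : ℕ) (c : Fin (m + 1) → ℤ) (j : Fin (m + 1)) (C : ℝ) : Prop :=
  ∀ (X : Type u) [MeasurableSpace X] (μ : Measure X) [IsProbabilityMeasure μ] (T : X ≃ᵐ X),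
    MeasurePreserving T μ μ → ∀ b : ℕ → ℂ, (∀ n, ‖b n‖ ≤ 1) →
    ∀ f : Fin (m + 1) → X → ℂ, (∀ i, f i ∈ unitFunctions X) →
    ∀ Φ : ℕ → Finset ℕ, IsFolnerSeq Φ →
      AsympLE (fun N => l2Norm μ (intErgodicAverage T c b f (Φ N)))
        (C * uniformitySeminorm μ T (m + 2) (f j))

theorem correlationBound_zero (c : Fin 1 → ℤ) (j : Fin 1) : CorrelationBound.{u} 0 c j 1 := by
  intro X _ μ _ T hT b hb f hf Φ hΦ
  refine AsympLE.of_le fun N => ?_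
  obtain rfl := Subsingleton.elim j 0
  have h1 : ∀ n : ℕ, ∫ x, ∏ i, f i (intIterate T (c i * n) x) ∂μ = ∫ x, f 0 x ∂μ := by
    intro n
    have h2 : ∀ x, ∏ i, f i (intIterate T (c i * n) x) = f 0 (intIterate T (c 0 * n) x) :=
      fun x => Fin.prod_univ_one fun i => f i (intIterate T (c i * n) x)
    simp only [h2]
    exact integral_intIterate hT _ (hf 0).1
  have h2 := norm_integral_le_uniformitySeminorm hT
    (unitFunctions.mem_boundedMeasurable (hf 0))
  simp only [h1, one_mul]
  refine le_trans ?_ h2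
  have hc : (0 : ℝ) < (Φ N).card := by exact_mod_cast (hΦ.1 N).card_pos
  rw [finsetMean, norm_smul, norm_inv, Complex.norm_natCast, inv_mul_le_iff₀ hc]
  refine (norm_sum_le_of_le (Φ N) (f := fun n => b n * ∫ x, f 0 x ∂μ)
    (n := fun _ => ‖∫ x, f 0 x ∂μ‖) fun n _ => ?_).trans_eq (by simp)
  rw [norm_mul]
  exact mul_le_of_le_one_left (norm_nonneg _) (hb n)

/-- The inner product of the terms at `n + d` and `n` is a correlation of derivatives. Only `c j ≠
0` is needed, so that the lags `c j * d` form a genuine progression. -/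
theorem CorrelationBound.averageBound {m : ℕ} {c : Fin (m + 1) → ℤ} {j : Fin (m + 1)} {C : ℝ}
    (hC : 0 ≤ C) (hj : c j ≠ 0) (h : CorrelationBound.{u} m c j C) :
    AverageBound.{u} m c j (Real.sqrt (2 * C * (c j).natAbs)) := by
  intro X _ μ _ T hT b hb f hf Φ hΦ
  have hG : ∀ (d : ℕ) (i : Fin (m + 1)),
      (fun x => (starRingEnd ℂ) (f i (intIterate T (c i * d) x)) * f i x) ∈ unitFunctions X :=
    fun d i => unitFunctions.mul (unitFunctions.conj (unitFunctions.comp (hf i)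
      (measurePreserving_intIterate hT _).measurable)) (hf i)
  refine AsympLE.uniformitySeminorm_succ hT m (unitFunctions.mem_boundedMeasurable (hf j)) hj hC
    fun H hH => ?_
  refine vanDerCorput_l2Norm hT hΦ (fun n => unitFunctions.ergodicTerm hT c (hb n) hf n)
    (fun d => mul_nonneg hC (uniformitySeminorm_nonneg hT m
      (unitFunctions.mem_boundedMeasurable (hG d j)))) (fun d => ?_) hH
  have h1 := h X μ T hT (fun n => (starRingEnd ℂ) (b (n + d)) * b n) (fun n => by
    rw [norm_mul, RCLike.norm_conj]
    exact mul_le_one₀ (hb _) (norm_nonneg _) (hb n)) _ (hG d) Φ hΦ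
  refine h1.mono_left fun N => le_of_eq ?_
  congr 2
  ext n
  rw [← integral_const_mul]
  congr 1
  ext x
  rw [map_mul, map_prod, mul_mul_mul_comm, ← Finset.prod_mul_distrib]
  congr 1
  refine Finset.prod_congr rfl fun i _ => ?_
  rw [← intIterate_add, ← mul_add, Nat.cast_add, add_comm (d : ℤ)]

theorem AverageBound.correlationBound {m : ℕ} {c : Fin (m + 2) → ℤ} {i : Fin (m + 2)}
    {k : Fin (m + 1)} {C : ℝ} (h : AverageBound.{u} m (fun l => c (i.succAbove l) - c i) k C) :
    CorrelationBound.{u} (m + 1) c (i.succAbove k) C := by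
  intro X _ μ _ T hT b hb f hf Φ hΦ
  have hf' : ∀ l, f (i.succAbove l) ∈ unitFunctions X := fun l => hf _
  refine (h X μ T hT b hb (fun l => f (i.succAbove l)) hf' Φ hΦ).mono_left fun N => ?_
  refine le_trans (le_of_eq ?_) (norm_integral_mul_le_l2Norm (hf i)
    (unitFunctions.ergodicAverage hT (fun l => c (i.succAbove l) - c i) hb hf' (Φ N)))
  have h1 : ∀ n : ℕ, ∫ x, ∏ l, f l (intIterate T (c l * n) x) ∂μ =
      ∫ x, f i x * ∏ l, f (i.succAbove l) (intIterate T ((c (i.succAbove l) - c i) * n) x) ∂μ := by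
    intro n
    -- Translation by `T^{-c_i n}` frees `f i` from `n`, so it can be taken out of the average.
    rw [← integral_intIterate hT (-(c i * n)) (unitFunctions.prod Finset.univ fun l =>
      unitFunctions.comp (hf l) (measurePreserving_intIterate hT (c l * n)).measurable).1]
    congr 1
    ext x
    simp only [← intIterate_add]
    rw [Fin.prod_univ_succAbove _ i, add_neg_cancel, intIterate_zero]
    congr 1
    refine Finset.prod_congr rfl fun l _ => ?_
    congr 2
    ring
  have h2 : ∀ x, f i x * intErgodicAverage T (fun l => c (i.succAbove l) - c i) b
      (fun l => f (i.succAbove l)) (Φ N) x = ((Φ N).card : ℂ)⁻¹ * ∑ n ∈ Φ N, b n *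
        (f i x * ∏ l, f (i.succAbove l) (intIterate T ((c (i.succAbove l) - c i) * n) x)) := by
    intro x
    rw [intErgodicAverage, finsetMean, smul_eq_mul, mul_left_comm, Finset.mul_sum]
    congr 1
    exact Finset.sum_congr rfl fun n _ => mul_left_comm _ _ _
  simp only [h2]
  rw [integral_const_mul, integral_finsetSum]
  · rw [finsetMean, smul_eq_mul]
    congr 2
    refine Finset.sum_congr rfl fun n _ => ?_
    rw [integral_const_mul, h1]
  · intro n _
    refine (integrable_of_boundedMeasurable (unitFunctions.mem_boundedMeasurable
      (unitFunctions.mul (hf i) (unitFunctions.prod Finset.univ fun l => unitFunctions.comp (hf' l)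
        (measurePreserving_intIterate hT ((c (i.succAbove l) - c i) * n)).measurable)))).const_mul
          _

theorem exists_correlationBound (m : ℕ) : ∀ c : Fin (m + 1) → ℤ, Function.Injective c →
    ∀ j, ∃ C : ℝ, 0 ≤ C ∧ CorrelationBound.{u} m c j C := by
  induction m with
  | zero => exact fun c _ j => ⟨1, zero_le_one, correlationBound_zero c j⟩
  | succ m ih =>
    intro c hc j
    -- Any index other than `j` can be removed by Cauchy–Schwarz. Injectivity of `c` makes the new
    -- exponent of `f j` nonzero, so zero exponents are allowed in correlations.
    obtain ⟨i, hi⟩ := exists_ne j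
    obtain ⟨k, rfl⟩ := Fin.exists_succAbove_eq hi.symm
    obtain ⟨C, hC, h⟩ := ih (fun l => c (i.succAbove l) - c i)
      (fun a b hab => Fin.succAbove_right_injective (hc (sub_left_injective hab))) k
    refine ⟨_, Real.sqrt_nonneg _, (h.averageBound hC ?_).correlationBound⟩
    exact sub_ne_zero.2 fun hki => Fin.succAbove_ne i k (hc hki)

theorem exists_averageBound (m : ℕ) (c : Fin (m + 1) → ℤ) (hc : Function.Injective c)
    (hc0 : ∀ i, c i ≠ 0) (j : Fin (m + 1)) : ∃ C : ℝ, 0 ≤ C ∧ AverageBound.{u} m c j C := by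
  obtain ⟨C, hC, h⟩ := exists_correlationBound.{u} m c hc j
  exact ⟨_, Real.sqrt_nonneg _, h.averageBound hC (hc0 j)⟩

/-! ### From `L^∞` functions to functions bounded everywhere, and conclusion -/

theorem exists_unitFunctions_ae_eq {X : Type*} [MeasurableSpace X] {μ : Measure X} {f : X → ℂ}
    (hf : MemLp f ∞ μ) (hf1 : eLpNorm f ∞ μ ≤ 1) : ∃ F ∈ unitFunctions X, f =ᵐ[μ] F := by
  obtain ⟨g, hg, hfg⟩ := hf.aestronglyMeasurable.aemeasurable
  refine ⟨{x | ‖g x‖ ≤ 1}.indicator g,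
    ⟨hg.indicator (measurableSet_le hg.norm measurable_const), fun x => ?_⟩, ?_⟩
  · by_cases hx : ‖g x‖ ≤ 1
    · rwa [Set.indicator_of_mem (show x ∈ {x | ‖g x‖ ≤ 1} from hx)]
    · rw [Set.indicator_of_notMem (show x ∉ {x | ‖g x‖ ≤ 1} from hx), norm_zero]
      exact zero_le_one
  · have h1 : ∀ᵐ x ∂μ, ‖f x‖ₑ ≤ 1 := by
      rw [eLpNorm_exponent_top] at hf1
      exact (ae_le_eLpNormEssSup (f := f)).mono fun x hx => hx.trans hf1
    filter_upwards [hfg, h1] with x hx hx1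
    have h2 : ‖g x‖ ≤ 1 := by
      rw [← hx]
      rw [← ofReal_norm, ENNReal.ofReal_le_one] at hx1
      exact hx1
    rw [Set.indicator_of_mem (show x ∈ {x | ‖g x‖ ≤ 1} from h2), hx]

theorem proposition5p1 (s : ℕ) (hs : 1 ≤ s) (c : Fin s → ℕ) (hc : ∀ i, 1 ≤ c i)
    (hdist : Function.Injective c) :
    ∃ C : ℝ, ∀ (X : Type*) [MeasurableSpace X] (μ : Measure X) [IsProbabilityMeasure μ]
      (T : X ≃ᵐ X), MeasurePreserving T μ μ →
      ∀ b : ℕ → ℂ, (∀ n, ‖b n‖ ≤ 1) →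
      ∀ f : Fin s → X → ℂ, (∀ i, MemLp (f i) ∞ μ) → (∀ i, eLpNorm (f i) ∞ μ ≤ 1) →
      ∀ Φ : ℕ → Finset ℕ, IsFolnerSeq Φ →
        limsup (fun N => eLpNorm (weightedErgodicAverage T c b f (Φ N)) 2 μ) atTop ≤
          ENNReal.ofReal (C * ⨅ i : Fin s, uniformitySeminorm μ T (s + 1) (f i)) := by
  obtain ⟨m, rfl⟩ : ∃ m, s = m + 1 := ⟨s - 1, by omega⟩
  choose C hC0 hC using exists_averageBound m (fun i => (c i : ℤ))
    (Nat.cast_injective.comp hdist) (fun i => by have := hc i; omega)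
  -- The index attaining the minimum depends on the system, so one constant must dominate every `C
  -- j`; these are nonnegative.
  refine ⟨∑ j, C j, ?_⟩
  intro X _ μ _ T hT b hb f hf hf1 Φ hΦ
  choose F hF hfF using fun i => exists_unitFunctions_ae_eq (hf i) (hf1 i)
  obtain ⟨j, hj⟩ := exists_eq_ciInf_of_finite
    (f := fun i => uniformitySeminorm μ T (m + 1 + 1) (f i))
  rw [← hj, uniformitySeminorm_congr_ae hT _ _ _ (hfF j)]
  have hUj : 0 ≤ uniformitySeminorm μ T (m + 1 + 1) (F j) :=
    uniformitySeminorm_nonneg hT _ (unitFunctions.mem_boundedMeasurable (hF j))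
  have hav : ∀ N, eLpNorm (weightedErgodicAverage T c b f (Φ N)) 2 μ =
      ENNReal.ofReal (l2Norm μ (intErgodicAverage T (fun i => (c i : ℤ)) b F (Φ N))) := by
    intro N
    rw [← ofReal_l2Norm (unitFunctions.ergodicAverage hT _ hb hF _)]
    refine eLpNorm_congr_ae ?_
    have h1 : ∀ᵐ x ∂μ, ∀ (i : Fin (m + 1)) (n : ℕ), f i (T^[c i * n] x) = F i (T^[c i * n] x) :=
      ae_all_iff.2 fun i => ae_all_iff.2 fun n =>
        (hT.iterate (c i * n)).quasiMeasurePreserving.ae_eq_comp (hfF i)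
    filter_upwards [h1] with x hx
    simp only [weightedErgodicAverage, intErgodicAverage, finsetMean, hx, smul_eq_mul, one_div,
      ← Nat.cast_mul, intIterate_natCast]
  simp only [hav]
  refine (hC j X μ T hT b hb F hF Φ hΦ).limsup_le.trans (ENNReal.ofReal_le_ofReal ?_)
  exact mul_le_mul_of_nonneg_right
    (Finset.single_le_sum (fun i _ => hC0 i) (Finset.mem_univ j)) hUj
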